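/- All graphs are finite, undirected and simple. For a graph $G$ on $n$ vertices let $\mu_1(G)\le\mu_2(G)\le\cdots\le\mu_n(G)$ be the eigenvalues, with multiplicity, of its Laplacian matrix $L(G)=D(G)-A(G)$ (degree matrix minus adjacency matrix), and let $t(G)$ be the number of spanning trees of $G$. The subdivision graph $\mathcal S(G)$ is obtained from $G$ by inserting a new vertex into every edge of $G$. For graphs $G_1$ and $G_2$, the subdivision-vertex neighbourhood corona $G_1\boxdot G_2$ is the graph obtained from $\mathcal S(G_1)$ and $|V(G_1)|$ copies of $G_2$, one for each vertex of $G_1$, all vertex-disjoint, by joining, for each $v\in V(G_1)$, all neighbours of $v$ in $\mathcal S(G_1)$ to every vertex of the copy of $G_2$ that belongs to $v$. Let $G_1$ be an $r_1$-regular graph with $n_1\ge 1$ vertices and $m_1$ edges, and let $G_2$ be an arbitrary graph with $n_2$ vertices. Then $$t(G_1\boxdot G_2)=\frac{(2+2n_2+r_1)\cdot(2+2n_2)^{m_1-n_1}\cdot\prod_{i=1}^{n_2}\bigl(r_1+\mu_i(G_2)\bigr)^{n_1}\cdot\prod_{i=2}^{n_1}(1+n_2)\mu_i(G_1)}{n_1+m_1+n_1n_2},$$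 where the exponent $m_1-n_1$ is an integer that may be negative, and the factor $1+n_2$ belongs to each term of the last product. -/

import Mathlib

namespace SimpleGraph

/-- The subdivision graph of `G`: its vertices are the vertices of `G` together with one new vertex
for every edge of `G`, and the new vertex of an edge `e` is joined to the two ends of `e`
(and to nothing else). -/
def subdivisionGraph {V : Type*} (G : SimpleGraph V) : SimpleGraph (V ⊕ G.edgeSet) where
  Adj
    | .inl v, .inr e => v ∈ (e : Sym2 V)
    | .inr e, .inl v => v ∈ (e : Sym2 V)
    | .inl _, .inl _ => False
    | .inr _, .inr _ => False
  symm := ⟨by rintro (v | e) (w | f) h <;> exact h⟩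
  loopless := ⟨by rintro (v | e) h <;> exact h⟩

/-- The subdivision-vertex neighbourhood corona of `G₁` and `G₂`: the disjoint union of the
subdivision graph of `G₁` and of one copy of `G₂` for each vertex of `G₁` (the vertex `(i, u)` is
the vertex `u` of the `i`-th copy), where moreover the neighbours in the subdivision graph
of each vertex `i` of `G₁` are joined to all vertices of the `i`-th copy of `G₂`. -/
def subdivisionVertexNeighbourhoodCorona {V₁ V₂ : Type*} (G₁ : SimpleGraph V₁)
    (G₂ : SimpleGraph V₂) : SimpleGraph ((V₁ ⊕ G₁.edgeSet) ⊕ (V₁ × V₂)) where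
  Adj
    | .inl a, .inl b => G₁.subdivisionGraph.Adj a b
    | .inr p, .inr q => p.1 = q.1 ∧ G₂.Adj p.2 q.2
    | .inl a, .inr p => G₁.subdivisionGraph.Adj (.inl p.1) a
    | .inr p, .inl a => G₁.subdivisionGraph.Adj (.inl p.1) a
  symm := ⟨by
    rintro (a | p) (b | q) h
    · exact h.symm
    · exact h
    · exact h
    · exact ⟨h.1.symm, h.2.symm⟩⟩
  loopless := ⟨by
    rintro (a | p) h
    · exact G₁.subdivisionGraph.irrefl h
    · exact G₂.irrefl h.2⟩

/-- The number of spanning trees of `G`: the number of trees on the whole vertex set of `G` all of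
whose edges are edges of `G`. -/
noncomputable def numSpanningTrees {V : Type*} (G : SimpleGraph V) : ℕ :=
  Nat.card {T : SimpleGraph V // T ≤ G ∧ T.IsTree}

/-- The Laplacian eigenvalues of `G`, with multiplicity, in increasing order. The indices start
at `0`, so that the eigenvalue `μ_i` in the order `μ_1 ≤ μ_2 ≤ ⋯ ≤ μ_n` has index `i - 1`. -/
noncomputable def laplacianEigenvalue {V : Type*} [Fintype V] [DecidableEq V] (G : SimpleGraph V)
    [DecidableRel G.Adj] (i : Fin (Fintype.card V)) : ℝ :=
  (G.isHermitian_lapMatrix ℝ).eigenvalues₀ i.rev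

end SimpleGraph

/-!
The proof counts the spanning trees by determinants of Laplacian matrices.

Matrix-tree theorem. Replace the row of a vertex `r` of the Laplacian by the unit vector `e_r`.
Every other row `i` is the sum of the vectors `e_i - e_j` over the neighbours `j` of `i`, so by
multilinearity the determinant is a sum over maps `f` choosing a neighbour `f i` of each `i ≠ r`.
The determinant of the rows `e_i - e_{f i}` is `1` if iterating `f` leads every vertex to `r` (the
matrix is unitriangular), and `0` otherwise (the vertices which never reach `r` give a kernel
vector). The maps of the first kind, parent maps, are the spanning trees with all edges oriented
towards `r` (`numSpanningTrees_eq_card_isParentMap`), so the determinant is the number `t` of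
spanning trees. Row operations turn this into
`det (L + u vᵀ) = (∑ u) (∑ v) t` (`det_lapMatrix_add_vecMulVec`), and comparing with the
characteristic polynomial gives `n t = μ₂ ⋯ μₙ` (`card_mul_numSpanningTrees`).

Corona. For the Laplacian of the corona, let `u` be the indicator of the vertices of `G₁` and of
all the copies of `G₂`, and `v` the indicator of the vertices of `G₁`. Subtract in `L + u vᵀ` the
row of each vertex `i` of `G₁` from the rows of the `i`-th copy, and add the columns of
the `i`-th copy to the column of `i`. The result is block triangular: the copies contribute
`det (r₁ + L(G₂)) ^ n₁`. In the remaining block, indexed by the vertices and edges of `G₁`, the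
Schur complement of the edge block `(2 + 2 n₂) I` is `L(G₁) / 2 + J`, because `R Rᵀ = 2 r₁ - L(G₁)`
for the incidence matrix `R`, where `J` is the all-ones matrix. Its determinant is given by the
matrix-tree theorem for `G₁`, which expresses `t(G₁ ⊡ G₂)` through `t(G₁)`
(`card_mul_numSpanningTrees_corona`).
-/

open Finset Matrix

namespace SimpleGraph

/-! ### Spanning trees as parent maps -/

variable {V : Type*}

/-- `f` is a parent map of `G` rooted at `r`: it fixes `r`, it sends every other vertex to one of
its neighbours, and iterating it leads from every vertex to `r`. -/
structure IsParentMap (G : SimpleGraph V) (r : V) (f : V → V) : Prop where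
  root : f r = r
  adj : ∀ i, i ≠ r → G.Adj i (f i)
  reach : ∀ i, ∃ k, f^[k] i = r

/-- The graph whose edges join each vertex `i` to `f i`, whenever the two are distinct. -/
def functionGraph (f : V → V) : SimpleGraph V := fromRel fun i j => f i = j

theorem functionGraph_adj {f : V → V} {i j : V} :
    (functionGraph f).Adj i j ↔ i ≠ j ∧ (f i = j ∨ f j = i) := by
  simp [functionGraph]

theorem reachable_functionGraph_iterate (f : V → V) (i : V) (k : ℕ) :
    (functionGraph f).Reachable i (f^[k] i) := by
  induction k generalizing i with
  | zero => exact Reachable.refl _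
  | succ k ih =>
    rw [Function.iterate_succ_apply]
    refine Reachable.trans ?_ (ih (f i))
    by_cases h : i = f i
    · rw [← h]
    · exact Adj.reachable (functionGraph_adj.2 ⟨h, Or.inl rfl⟩)

namespace IsParentMap

variable {G : SimpleGraph V} {r : V} {f g : V → V}

theorem functionGraph_le (hf : G.IsParentMap r f) : functionGraph f ≤ G := by
  have key : ∀ i j, i ≠ j → f i = j → G.Adj i j := by
    rintro i j hij rfl
    exact hf.adj i fun h => hij (by rw [h, hf.root])
  intro i j h
  obtain ⟨hij, h | h⟩ := functionGraph_adj.1 h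
  · exact key i j hij h
  · exact (key j i hij.symm h).symm

theorem connected_functionGraph (hf : G.IsParentMap r f) : (functionGraph f).Connected := by
  have key : ∀ i, (functionGraph f).Reachable i r := fun i => by
    obtain ⟨k, hk⟩ := hf.reach i
    exact hk ▸ reachable_functionGraph_iterate f i k
  have : Nonempty V := ⟨r⟩
  exact ⟨fun i j => (key i).trans (key j).symm⟩

theorem isTree_functionGraph [Finite V] (hf : G.IsParentMap r f) : (functionGraph f).IsTree := by
  classical
  have := Fintype.ofFinite V
  refine isTree_iff_connected_and_card.2 ⟨hf.connected_functionGraph, le_antisymm ?_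
    hf.connected_functionGraph.card_vert_le_card_edgeSet_add_one⟩
  -- Every edge is `s(i, f i)` for some `i ≠ r`.
  have hsub : (functionGraph f).edgeSet ⊆ ((univ.erase r).image fun i => s(i, f i) : Finset _) := by
    have key : ∀ i j, i ≠ j → f i = j →
        s(i, j) ∈ ((univ.erase r).image fun i => s(i, f i) : Finset _) := by
      rintro i j hij rfl
      exact mem_image_of_mem _ (mem_erase.2 ⟨fun h => hij (by rw [h, hf.root]), mem_univ _⟩)
    intro e
    induction e with | _ i j =>
    intro h
    obtain ⟨hij, h | h⟩ := functionGraph_adj.1 h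
    · exact key i j hij h
    · rw [Sym2.eq_swap]
      exact key j i hij.symm h
  have h1 : Nat.card (functionGraph f).edgeSet ≤ (univ.erase r).card := by
    rw [Nat.card_coe_set_eq]
    refine (Set.ncard_le_ncard hsub (Finset.finite_toSet _)).trans ?_
    rw [Set.ncard_coe_finset]
    exact card_image_le
  have h2 := card_erase_add_one (mem_univ r)
  rw [card_univ, ← Nat.card_eq_fintype_card] at h2
  omega

/-- A parent map is determined by its edges: the vertices where two parent maps with the same
edges differ form a set closed under the maps, and the root is not in it. -/
theorem eq_of_functionGraph_eq (hf : G.IsParentMap r f) (hg : G.IsParentMap r g)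
    (h : functionGraph f = functionGraph g) : f = g := by
  have step : ∀ i, f i ≠ g i → f (f i) ≠ g (f i) := by
    intro i hi
    have hir : i ≠ r := fun e => hi (by rw [e, hf.root, hg.root])
    have hadj : (functionGraph g).Adj i (f i) :=
      h ▸ functionGraph_adj.2 ⟨(hf.adj i hir).ne, Or.inl rfl⟩
    obtain ⟨-, e | e⟩ := functionGraph_adj.1 hadj
    · exact absurd e.symm hi
    · -- Here `g` swaps the edge, so `f` and `g` cannot agree at `f i`: else `f` has a 2-cycle.
      intro e'
      rw [e] at e'
      have hcyc : ∀ k, f^[k] i = i ∨ f^[k] i = f i := by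
        intro k
        induction k with
        | zero => exact Or.inl rfl
        | succ k ih =>
          rw [Function.iterate_succ_apply']
          rcases ih with ih | ih <;> rw [ih]
          · exact Or.inr rfl
          · exact Or.inl e'
      obtain ⟨k, hk⟩ := hf.reach i
      rcases hcyc k with h' | h'
      · exact hir (h'.symm.trans hk)
      · have : f i = r := h'.symm.trans hk
        rw [this, hf.root] at e'
        exact hir e'.symm
  by_contra hne
  obtain ⟨i, hi⟩ := Function.ne_iff.1 hne
  have hall : ∀ k, f (f^[k] i) ≠ g (f^[k] i) := by
    intro k
    induction k with
    | zero => exact hi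
    | succ k ih =>
      rw [Function.iterate_succ_apply']
      exact step _ ih
  obtain ⟨k, hk⟩ := hf.reach i
  exact hall k (by rw [hk, hf.root, hg.root])

end IsParentMap

/-- In a connected graph, stepping to a neighbour closer to `r` is a parent map. -/
theorem Connected.exists_isParentMap {T : SimpleGraph V} (hT : T.Connected) (r : V) :
    ∃ f, T.IsParentMap r f := by
  have hstep : ∀ i, ∃ j, (i = r → j = r) ∧ (i ≠ r → T.Adj i j ∧ T.dist j r < T.dist i r) := by
    intro i
    by_cases hir : i = r
    · exact ⟨r, fun _ => rfl, fun h => absurd hir h⟩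
    · obtain ⟨p, hp⟩ := hT.exists_walk_length_eq_dist i r
      cases p with
      | nil => exact absurd rfl hir
      | cons hadj q =>
        refine ⟨_, fun h => absurd h hir, fun _ => ⟨hadj, ?_⟩⟩
        rw [← hp, Walk.length_cons]
        exact Nat.lt_succ_of_le (dist_le q)
  choose f hf using hstep
  refine ⟨f, (hf r).1 rfl, fun i hi => ((hf i).2 hi).1, fun i => ?_⟩
  induction hd : T.dist i r using Nat.strong_induction_on generalizing i with
  | _ d ih =>
    by_cases hir : i = r
    · exact ⟨0, hir⟩
    · obtain ⟨k, hk⟩ := ih _ (hd ▸ ((hf i).2 hir).2) (f i) rfl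
      exact ⟨k + 1, hk⟩

/-- Spanning trees correspond to parent maps: orient every edge towards the root `r`. -/
theorem numSpanningTrees_eq_card_isParentMap [Finite V] (G : SimpleGraph V) (r : V) :
    G.numSpanningTrees = Nat.card {f : V → V // G.IsParentMap r f} := by
  symm
  refine Nat.card_congr (Equiv.ofBijective
    (fun f => ⟨functionGraph f.1, f.2.functionGraph_le, f.2.isTree_functionGraph⟩) ⟨?_, ?_⟩)
  · intro f g h
    exact Subtype.ext (f.2.eq_of_functionGraph_eq g.2 (congrArg Subtype.val h))
  · rintro ⟨T, hTG, hT⟩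
    obtain ⟨f, hf⟩ := hT.connected.exists_isParentMap r
    refine ⟨⟨f, hf.root, fun i hi => hTG (hf.adj i hi), hf.reach⟩, Subtype.ext ?_⟩
    exact le_antisymm hf.functionGraph_le
      ((isTree_iff_minimal_connected.1 hT).2 hf.connected_functionGraph hf.functionGraph_le)

/-! ### The matrix-tree theorem -/

section MatrixTree

variable [Fintype V] [DecidableEq V]

theorem IsParentMap.det_eq_one {G : SimpleGraph V} {r : V} {f : V → V} (hf : G.IsParentMap r f) :
    (of fun i => if i = r then Pi.single r (1 : ℝ) else Pi.single i 1 - Pi.single (f i) 1).det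
      = 1 := by
  -- The matrix is unitriangular once the vertices are ordered by their distance to the root.
  set b : V → ℕ := fun i => Nat.find (hf.reach i) with hb
  have hlt : ∀ i, i ≠ r → b (f i) < b i := by
    intro i hi
    have hs : f^[b i] i = r := Nat.find_spec (hf.reach i)
    obtain ⟨k, hk⟩ : ∃ k, b i = k + 1 := Nat.exists_eq_succ_of_ne_zero fun h0 =>
      hi (by rwa [h0] at hs)
    rw [hk, Function.iterate_succ_apply] at hs
    have : b (f i) ≤ k := Nat.find_min' (hf.reach (f i)) hs
    omega
  rw [← det_transpose]
  have htri : BlockTriangular (of fun i => if i = r then Pi.single r (1 : ℝ)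
      else Pi.single i 1 - Pi.single (f i) 1)ᵀ b := by
    intro j i hij
    have hji : j ≠ i := by rintro rfl; exact lt_irrefl _ hij
    by_cases hi : i = r
    · subst hi
      simp [hji]
    · have : j ≠ f i := by rintro rfl; exact lt_asymm hij (hlt i hi)
      simp [hi, hji, this]
  rw [htri.det]
  refine prod_eq_one fun a _ => ?_
  convert det_one (R := ℝ) (n := {i // b i = a})
  ext ⟨j, hj⟩ ⟨i, hi⟩
  simp only [toSquareBlock_def, transpose_apply, of_apply, one_apply, Subtype.mk.injEq]
  by_cases hir : i = r
  · subst hir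
    simp [Pi.single_apply]
  · have : j ≠ f i := by
      rintro rfl
      have := hlt i hir
      omega
    simp [hir, Pi.single_apply, this]

/-- If iterating `f` does not lead every vertex to `r`, the indicator of the vertices which never
reach `r` is in the kernel. -/
theorem det_eq_zero_of_not_reach {r : V} {f : V → V} (hf : ¬∀ i, ∃ k, f^[k] i = r) :
    (of fun i => if i = r then Pi.single r (1 : ℝ) else Pi.single i 1 - Pi.single (f i) 1).det
      = 0 := by
  classical
  push Not at hf
  obtain ⟨i₀, hi₀⟩ := hf
  refine exists_mulVec_eq_zero_iff.1
    ⟨fun i => if ∃ k, f^[k] i = r then 0 else 1, Function.ne_iff.2 ⟨i₀, ?_⟩, ?_⟩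
  · simp [hi₀]
  · ext i
    by_cases hi : i = r
    · have : ∃ k, f^[k] r = r := ⟨0, rfl⟩
      simp [mulVec, hi, this]
    · have : (∃ k, f^[k] i = r) ↔ ∃ k, f^[k] (f i) = r := by
        constructor
        · rintro ⟨_ | k, hk⟩
          · exact absurd hk hi
          · exact ⟨k, hk⟩
        · rintro ⟨k, hk⟩
          exact ⟨k + 1, hk⟩
      simp only [mulVec, of_apply, if_neg hi, sub_dotProduct, single_one_dotProduct, this, sub_self,
        Pi.zero_apply]

theorem lapMatrix_row_eq_sum (G : SimpleGraph V) [DecidableRel G.Adj] (i : V) :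
    G.lapMatrix ℝ i = ∑ j ∈ G.neighborFinset i, (Pi.single i 1 - Pi.single j 1) := by
  ext k
  rw [Finset.sum_apply]
  simp [lapMatrix, degMatrix, diagonal_apply, Pi.single_apply, adjMatrix_apply, eq_comm]

/-- The **matrix-tree theorem**, with the row of the root replaced by a unit vector. -/
theorem det_updateRow_lapMatrix_single (G : SimpleGraph V) [DecidableRel G.Adj] (r : V) :
    ((G.lapMatrix ℝ).updateRow r (Pi.single r 1)).det = G.numSpanningTrees := by
  classical
  -- Expand the determinant along the rows: every row `i ≠ r` is the sum of `e_i - e_j`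
  -- over the neighbours `j` of `i`.
  have hrows : (G.lapMatrix ℝ).updateRow r (Pi.single r 1) = fun i =>
      ∑ j ∈ (if i = r then {r} else G.neighborFinset i),
        if i = r then Pi.single r (1 : ℝ) else Pi.single i 1 - Pi.single j 1 := by
    funext i
    by_cases hi : i = r
    · subst hi
      simp
    · rw [updateRow_ne hi, lapMatrix_row_eq_sum]
      simp [hi]
  have hexp := (detRowAlternating (R := ℝ) (n := V)).toMultilinearMap.map_sum_finset
    (fun i j => if i = r then Pi.single r (1 : ℝ) else Pi.single i 1 - Pi.single j 1)
    (fun i => if i = r then {r} else G.neighborFinset i)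
  rw [hrows]
  refine hexp.trans ?_
  have hterm : ∀ f ∈ Fintype.piFinset (fun i => if i = r then {r} else G.neighborFinset i),
      (of fun i => if i = r then Pi.single r (1 : ℝ) else Pi.single i 1 - Pi.single (f i) 1).det
        = if G.IsParentMap r f then 1 else 0 := by
    intro f hf
    rw [Fintype.mem_piFinset] at hf
    split_ifs with h
    · exact h.det_eq_one
    · refine det_eq_zero_of_not_reach fun hreach => h ⟨?_, fun i hi => ?_, hreach⟩
      · simpa using hf r
      · simpa [hi] using hf i
  refine (sum_congr rfl hterm).trans ?_
  rw [sum_boole, numSpanningTrees_eq_card_isParentMap G r, Nat.card_eq_fintype_card,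
    Fintype.card_subtype]
  congr 2
  ext f
  simp only [mem_filter, Fintype.mem_piFinset, mem_univ, true_and, and_iff_right_iff_imp]
  intro hf i
  by_cases hi : i = r
  · subst hi
    simp [hf.root]
  · simp [hi, hf.adj i hi]

/-- Replacing a row of the Laplacian by `w` scales the tree number by the sum of the entries
of `w`: the vector `w - (∑ i, w i) e_r` has sum `0`, as the other rows have, so that replacing
the row by it gives a singular matrix. -/
theorem det_updateRow_lapMatrix (G : SimpleGraph V) [DecidableRel G.Adj] (r : V) (w : V → ℝ) :
    ((G.lapMatrix ℝ).updateRow r w).det = (∑ i, w i) * G.numSpanningTrees := by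
  have hw : w = (∑ i, w i) • Pi.single r 1 + (w - (∑ i, w i) • Pi.single r 1) := by simp
  have hzero : ((G.lapMatrix ℝ).updateRow r (w - (∑ i, w i) • Pi.single r 1)).det = 0 := by
    refine exists_mulVec_eq_zero_iff.1 ⟨fun _ => 1, Function.ne_iff.2 ⟨r, by simp⟩, ?_⟩
    ext i
    by_cases hi : i = r
    · subst hi
      simp [mulVec, dotProduct, ← mul_sum]
    · have := congrFun (G.lapMatrix_mulVec_const_eq_zero (R := ℝ)) i
      simpa [mulVec, hi] using this
  conv_lhs => rw [hw]
  rw [det_updateRow_add, det_updateRow_smul, hzero, det_updateRow_lapMatrix_single, add_zero]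

/-- A rank one perturbation turns the matrix-tree theorem into a statement about a full
determinant. -/
theorem det_lapMatrix_add_vecMulVec (G : SimpleGraph V) [DecidableRel G.Adj] [Nonempty V]
    (u v : V → ℝ) :
    (G.lapMatrix ℝ + vecMulVec u v).det = (∑ i, u i) * (∑ i, v i) * G.numSpanningTrees := by
  obtain ⟨r⟩ := ‹Nonempty V›
  have hcol : ∀ j, ∑ i, G.lapMatrix ℝ i j = 0 := by
    intro j
    have := congrFun (G.lapMatrix_mulVec_const_eq_zero (R := ℝ)) j
    simp only [mulVec, dotProduct, mul_one] at this
    refine Eq.trans ?_ this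
    exact sum_congr rfl fun i _ => (G.isSymm_lapMatrix (R := ℝ)).apply j i
  -- Add all the rows to row `r`.
  have h1 := det_updateRow_sum (G.lapMatrix ℝ + vecMulVec u v) r fun _ => 1
  have hrow : ∑ k, (1 : ℝ) • (G.lapMatrix ℝ + vecMulVec u v) k = (∑ i, u i) • v := by
    ext j
    rw [Finset.sum_apply]
    simp [sum_add_distrib, hcol, vecMulVec_apply, sum_mul]
  rw [hrow, one_smul, det_updateRow_smul] at h1
  rw [← h1, mul_assoc, ← det_updateRow_lapMatrix G r v]
  congr 1
  -- Clear the perturbation from the other rows with the new row `r`.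
  refine det_eq_of_forall_row_eq_smul_add_const (Function.update u r 0) r (by simp) fun i j => ?_
  by_cases hi : i = r
  · subst hi
    simp
  · simp [hi, vecMulVec_apply]

end MatrixTree

/-! ### Laplacian eigenvalues and the number of spanning trees -/

section Spectrum

variable {V : Type*} [Fintype V] [DecidableEq V] (G : SimpleGraph V) [DecidableRel G.Adj]

theorem det_smul_one_add_lapMatrix (x : ℝ) :
    (x • (1 : Matrix V V ℝ) + G.lapMatrix ℝ).det =
      ∏ i : Fin (Fintype.card V), (x + G.laplacianEigenvalue i) := by
  have h := congrArg (Polynomial.eval (-x)) (G.isHermitian_lapMatrix ℝ).charpoly_eq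
  rw [eval_charpoly, Polynomial.eval_prod] at h
  have hneg : x • (1 : Matrix V V ℝ) + G.lapMatrix ℝ = -(scalar V (-x) - G.lapMatrix ℝ) := by
    ext i j
    by_cases hij : i = j <;> simp [hij, add_comm]
  have hcard : (-1 : ℝ) ^ Fintype.card V = ∏ _i : V, -1 := by simp
  rw [hneg, det_neg, h, hcard, ← prod_mul_distrib,
    ← (Fintype.equivOfCardEq (Fintype.card_fin (Fintype.card V))).prod_comp,
    ← Equiv.prod_comp Fin.revPerm]
  refine prod_congr rfl fun i _ => ?_
  simp [IsHermitian.eigenvalues, laplacianEigenvalue]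
  ring

theorem laplacianEigenvalue_mono : Monotone G.laplacianEigenvalue := fun _ _ h =>
  (G.isHermitian_lapMatrix ℝ).eigenvalues₀_antitone (Fin.rev_le_rev.2 h)

theorem laplacianEigenvalue_nonneg (i : Fin (Fintype.card V)) : 0 ≤ G.laplacianEigenvalue i := by
  have h := (posSemidef_lapMatrix ℝ G).eigenvalues_nonneg
    (Fintype.equivOfCardEq (Fintype.card_fin (Fintype.card V)) i.rev)
  simpa [IsHermitian.eigenvalues, laplacianEigenvalue] using h

theorem laplacianEigenvalue_eq_zero (i : Fin (Fintype.card V)) (hi : i.val = 0) :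
    G.laplacianEigenvalue i = 0 := by
  have hV : Nonempty V := Fintype.card_pos_iff.1 i.pos
  have h := G.det_smul_one_add_lapMatrix 0
  have hdet : (G.lapMatrix ℝ).det = 0 := exists_mulVec_eq_zero_iff.1
    ⟨fun _ => 1, Function.ne_iff.2 ⟨hV.some, by simp⟩, G.lapMatrix_mulVec_const_eq_zero⟩
  simp only [zero_smul, zero_add, hdet] at h
  obtain ⟨j, -, hj⟩ := prod_eq_zero_iff.1 h.symm
  exact le_antisymm (hj ▸ G.laplacianEigenvalue_mono (Fin.le_def.2 (by omega)))
    (G.laplacianEigenvalue_nonneg i)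

theorem det_smul_one_add_lapMatrix_eq_mul_prod [Nonempty V] (x : ℝ) :
    (x • (1 : Matrix V V ℝ) + G.lapMatrix ℝ).det =
      x * ∏ i : Fin (Fintype.card V) with 1 ≤ i.val, (x + G.laplacianEigenvalue i) := by
  rw [det_smul_one_add_lapMatrix, ← prod_filter_mul_prod_filter_not univ (fun i => i.val = 0)]
  congr 1
  · rw [prod_eq_single (⟨0, Fintype.card_pos⟩ : Fin (Fintype.card V))]
    · rw [laplacianEigenvalue_eq_zero _ _ rfl, add_zero]
    · intro j hj hne
      exact absurd (Fin.ext (mem_filter.1 hj).2) hne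
    · intro h
      exact absurd (by simp) h
  · refine prod_congr (filter_congr fun i _ => ?_) fun _ _ => rfl
    omega

/-- The matrix-tree theorem in terms of eigenvalues. Adding the all-ones matrix `J` to `x I + L`
only changes the factor `x` of the determinant, to `x + n`; at `x = 0` this is a statement about
`L + J`, whose determinant counts the spanning trees. -/
theorem card_mul_numSpanningTrees [Nonempty V] :
    (Fintype.card V : ℝ) * G.numSpanningTrees =
      ∏ i : Fin (Fintype.card V) with 1 ≤ i.val, G.laplacianEigenvalue i := by
  set n : ℝ := (Fintype.card V : ℝ) with hn
  set J : Matrix V V ℝ := vecMulVec 1 1 with hJ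
  have hn0 : n ≠ 0 := by simp [hn]
  have hLJ : G.lapMatrix ℝ * J = 0 := by
    have h1 : G.lapMatrix ℝ *ᵥ 1 = 0 := G.lapMatrix_mulVec_const_eq_zero
    rw [hJ, mul_vecMulVec, h1, zero_vecMulVec]
  have key : ∀ x : ℝ, x ≠ 0 → (x • (1 : Matrix V V ℝ) + G.lapMatrix ℝ + J).det =
      (x + n) * ∏ i : Fin (Fintype.card V) with 1 ≤ i.val, (x + G.laplacianEigenvalue i) := by
    intro x hx
    have hfac : x • (1 : Matrix V V ℝ) + G.lapMatrix ℝ + J =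
        (x • (1 : Matrix V V ℝ) + G.lapMatrix ℝ) * (1 + vecMulVec (x⁻¹ • 1) 1) := by
      rw [smul_vecMulVec, ← hJ, mul_add, mul_one, Matrix.mul_smul, add_mul, hLJ, Matrix.smul_mul, one_mul,
        add_zero, smul_smul, inv_mul_cancel₀ hx, one_smul]
    have hdet : (1 + vecMulVec (x⁻¹ • 1) 1 : Matrix V V ℝ).det = 1 + n / x := by
      rw [vecMulVec_eq Unit, det_one_add_replicateCol_mul_replicateRow]
      simp [dotProduct, hn, div_eq_mul_inv]
    rw [hfac, det_mul, hdet, det_smul_one_add_lapMatrix_eq_mul_prod]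
    field_simp
  have hcont : (fun x : ℝ => (x • (1 : Matrix V V ℝ) + G.lapMatrix ℝ + J).det) = fun x : ℝ =>
      (x + n) * ∏ i : Fin (Fintype.card V) with 1 ≤ i.val, (x + G.laplacianEigenvalue i) := by
    -- Both sides are polynomials in `x`, so the case `x = 0` follows by continuity.
    refine Continuous.ext_on (dense_compl_singleton (0 : ℝ)) ?_ (by fun_prop) fun x hx => key x hx
    exact Continuous.matrix_det (by fun_prop)
  have h0 := congrFun hcont 0
  simp only [zero_smul, zero_add] at h0
  rw [hJ, det_lapMatrix_add_vecMulVec] at h0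
  refine mul_left_cancel₀ hn0 ?_
  rw [← h0]
  simp [hn]
  ring

end Spectrum

/-! ### The Laplacian matrix of the corona -/

section Corona

/-- The vertex-edge incidence matrix of `G`, with the columns indexed by the edges of `G` only. -/
def edgeIncMatrix {V : Type*} [DecidableEq V] (G : SimpleGraph V) : Matrix V G.edgeSet ℝ :=
  of fun i e => if i ∈ (e : Sym2 V) then 1 else 0

theorem adjMatrix_corona {V₁ V₂ : Type*} [DecidableEq V₁] (G₁ : SimpleGraph V₁)
    (G₂ : SimpleGraph V₂) [DecidableRel G₂.Adj]
    [DecidableRel (G₁.subdivisionVertexNeighbourhoodCorona G₂).Adj] :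
    (G₁.subdivisionVertexNeighbourhoodCorona G₂).adjMatrix ℝ =
      fromBlocks (fromBlocks 0 G₁.edgeIncMatrix G₁.edgeIncMatrixᵀ 0)
        (of fun a p => Sum.elim (fun _ => 0) (fun e => G₁.edgeIncMatrix p.1 e) a)
        (of fun p a => Sum.elim (fun _ => 0) (fun e => G₁.edgeIncMatrix p.1 e) a)
        (of fun p q => if p.1 = q.1 ∧ G₂.Adj p.2 q.2 then 1 else 0) := by
  ext a b
  rw [adjMatrix_apply]
  rcases a with (i | e) | p <;> rcases b with (j | f) | q <;>
    simp only [fromBlocks_apply₁₁, fromBlocks_apply₁₂, fromBlocks_apply₂₁, fromBlocks_apply₂₂,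
      edgeIncMatrix, of_apply, transpose_apply, Matrix.zero_apply, Sum.elim_inl, Sum.elim_inr]
  case inl.inl.inl.inl => exact if_neg fun h => h
  case inl.inr.inl.inr => exact if_neg fun h => h
  case inl.inl.inr => exact if_neg fun h => h
  case inr.inl.inl => exact if_neg fun h => h
  all_goals exact if_congr Iff.rfl rfl rfl

variable {V₁ V₂ : Type*} [Fintype V₁] [DecidableEq V₁] [Fintype V₂] [DecidableEq V₂]
  (G₁ : SimpleGraph V₁) [DecidableRel G₁.Adj] (G₂ : SimpleGraph V₂) [DecidableRel G₂.Adj]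

theorem sum_edgeIncMatrix_mul (i j : V₁) :
    ∑ e : G₁.edgeSet, G₁.edgeIncMatrix i e * G₁.edgeIncMatrix j e =
      (G₁.incMatrix ℝ * (G₁.incMatrix ℝ)ᵀ) i j := by
  rw [mul_apply, ← sum_subset (subset_univ G₁.edgeFinset), ← sum_coe_sort G₁.edgeFinset]
  · refine Fintype.sum_equiv (Equiv.subtypeEquivRight fun e => by simp) _ _ fun e => ?_
    have he := e.2
    simp [edgeIncMatrix, incMatrix_apply', incidenceSet]
  · intro e _ he
    rw [mem_edgeFinset] at he
    rw [incMatrix_of_notMem_incidenceSet _ fun h => he h.1, zero_mul]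

theorem sum_edgeIncMatrix_row (i : V₁) :
    ∑ e : G₁.edgeSet, G₁.edgeIncMatrix i e = G₁.degree i := by
  have h := sum_edgeIncMatrix_mul G₁ i i
  rw [incMatrix_mul_transpose_diag] at h
  rw [← h]
  exact sum_congr rfl fun e _ => by simp [edgeIncMatrix]

theorem sum_edgeIncMatrix_col (e : G₁.edgeSet) : ∑ i, G₁.edgeIncMatrix i e = 2 := by
  rw [← G₁.sum_incMatrix_apply_of_mem_edgeSet e.2]
  refine sum_congr rfl fun i _ => ?_
  have he := e.2
  simp [edgeIncMatrix, incMatrix_apply', incidenceSet]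

theorem edgeIncMatrix_mul_transpose {r : ℕ} (hG : G₁.IsRegularOfDegree r) :
    G₁.edgeIncMatrix * G₁.edgeIncMatrixᵀ = (2 * r : ℝ) • 1 - G₁.lapMatrix ℝ := by
  ext i j
  rw [mul_apply]
  simp only [transpose_apply]
  rw [sum_edgeIncMatrix_mul, incMatrix_mul_transpose]
  by_cases hij : i = j
  · subst hij
    simp [lapMatrix, degMatrix, hG.degree_eq]
    ring
  · simp [lapMatrix, degMatrix, hij, adjMatrix_apply]

/-- The Laplacian matrix of the corona of a regular graph. The blocks are indexed by the vertices
of `G₁`, the edges of `G₁` and the vertices of the copies of `G₂`. -/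
theorem lapMatrix_corona {r : ℕ} (hG : G₁.IsRegularOfDegree r)
    [DecidableRel (G₁.subdivisionVertexNeighbourhoodCorona G₂).Adj] :
    (G₁.subdivisionVertexNeighbourhoodCorona G₂).lapMatrix ℝ =
      fromBlocks
        (fromBlocks ((r : ℝ) • 1) (-G₁.edgeIncMatrix) (-G₁.edgeIncMatrixᵀ)
          ((2 + 2 * (Fintype.card V₂ : ℝ)) • 1))
        (of fun a p => Sum.elim (fun _ => 0) (fun e => -G₁.edgeIncMatrix p.1 e) a)
        (of fun p a => Sum.elim (fun _ => 0) (fun e => -G₁.edgeIncMatrix p.1 e) a)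
        (kroneckerMap (· * ·) 1 ((r : ℝ) • 1 + G₂.lapMatrix ℝ)) := by
  have hs : ∀ p : V₁ × V₂, ∑ q : V₁ × V₂, (if p.1 = q.1 ∧ G₂.Adj p.2 q.2 then (1 : ℝ) else 0) =
      G₂.degree p.2 := by
    intro p
    rw [Fintype.sum_prod_type, sum_eq_single p.1]
    · rw [degree_eq_sum_if_adj]
      simp
    · intro i _ hi
      simp [hi.symm]
    · simp
  have hdeg : ∀ a, ((G₁.subdivisionVertexNeighbourhoodCorona G₂).degree a : ℝ) =
      Sum.elim (Sum.elim (fun _ => (r : ℝ)) fun _ => 2 + 2 * (Fintype.card V₂ : ℝ))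
        (fun p => r + (G₂.degree p.2 : ℝ)) a := by
    intro a
    rw [degree_eq_sum_if_adj]
    simp only [← adjMatrix_apply, adjMatrix_corona]
    rcases a with (i | e) | p
    · simp [Fintype.sum_sum_type, sum_edgeIncMatrix_row, hG.degree_eq]
    · simp [Fintype.sum_sum_type, Fintype.sum_prod_type_right, sum_edgeIncMatrix_col]
      ring
    · simp [Fintype.sum_sum_type, sum_edgeIncMatrix_row, hG.degree_eq, hs]
  ext a b
  rw [lapMatrix, Matrix.sub_apply, degMatrix, diagonal_apply, hdeg, adjMatrix_corona]
  rcases a with (i | e) | p <;> rcases b with (j | f) | q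
  · simp [one_apply]
  · simp
  · simp
  · simp
  · simp [one_apply]
  · simp
  · simp
  · simp
  · obtain ⟨i, u⟩ := p
    obtain ⟨j, w⟩ := q
    by_cases hij : i = j
    · by_cases huw : u = w <;> simp [hij, huw, lapMatrix, degMatrix, adjMatrix_apply]
    · simp [hij]

/-! ### The determinant for the corona -/

/-- A block triangularization by a similarity: subtract from the second block row `T` times the
first one, and add to the first block column the second one times `T`. -/
theorem det_fromBlocks_of_similar {m n : Type*} [Fintype m] [DecidableEq m] [Fintype n]
    [DecidableEq n] (A : Matrix m m ℝ) (B : Matrix m n ℝ) (C : Matrix n m ℝ) (D : Matrix n n ℝ)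
    (T : Matrix n m ℝ) (h : C - T * A + (D - T * B) * T = 0) :
    (fromBlocks A B C D).det = (A + B * T).det * (D - T * B).det := by
  have hmul : fromBlocks 1 0 (-T) 1 * fromBlocks A B C D * fromBlocks 1 0 T 1 =
      fromBlocks (A + B * T) B 0 (D - T * B) := by
    rw [fromBlocks_multiply, fromBlocks_multiply]
    congr 1
    · simp
    · simp
    · rw [← h]
      simp only [Matrix.neg_mul, Matrix.one_mul, Matrix.mul_one, Matrix.add_mul, Matrix.sub_mul]
      abel
    · simp only [Matrix.neg_mul, Matrix.one_mul, Matrix.mul_one, Matrix.mul_zero, zero_add]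
      abel
  rw [← det_fromBlocks_zero₂₁ (A + B * T) B, ← hmul, det_mul, det_mul]
  simp

/-- Subtracting from each vertex of a copy of `G₂` the row of the vertex of `G₁` to which the copy
belongs, and adding the columns of a copy to the column of that vertex, splits off the
Laplacians of the copies. -/
theorem card_mul_numSpanningTrees_corona [Nonempty V₁] {r : ℕ} (hG : G₁.IsRegularOfDegree r) :
    (1 + (Fintype.card V₂ : ℝ)) * (G₁.subdivisionVertexNeighbourhoodCorona G₂).numSpanningTrees =
      2 * (2 + 2 * (Fintype.card V₂ : ℝ)) ^ Fintype.card G₁.edgeSet / 2 ^ Fintype.card V₁ *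
        ((r : ℝ) • (1 : Matrix V₂ V₂ ℝ) + G₂.lapMatrix ℝ).det ^ Fintype.card V₁ *
        G₁.numSpanningTrees := by
  classical
  set H := G₁.subdivisionVertexNeighbourhoodCorona G₂ with hH
  set n₁ : ℝ := (Fintype.card V₁ : ℝ) with hn₁
  set n₂ : ℝ := (Fintype.card V₂ : ℝ) with hn₂
  have hn₁0 : n₁ ≠ 0 := by simp [hn₁]
  set c : ℝ := 2 + 2 * n₂ with hc
  have hc0 : c ≠ 0 := by positivity
  set R := G₁.edgeIncMatrix with hR
  set K := kroneckerMap (· * ·) (1 : Matrix V₁ V₁ ℝ) ((r : ℝ) • 1 + G₂.lapMatrix ℝ) with hK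
  set J : Matrix V₁ V₁ ℝ := vecMulVec 1 1 with hJ
  -- The perturbation is chosen so that the row operation removes it from the copies of `G₂`,
  -- and the column operation leaves it unchanged.
  set u : (V₁ ⊕ G₁.edgeSet) ⊕ (V₁ × V₂) → ℝ := Sum.elim (Sum.elim 1 0) 1 with hu
  set v : (V₁ ⊕ G₁.edgeSet) ⊕ (V₁ × V₂) → ℝ := Sum.elim (Sum.elim 1 0) 0 with hv
  set B : Matrix (V₁ ⊕ G₁.edgeSet) (V₁ × V₂) ℝ :=
    of fun a p => Sum.elim (fun _ => 0) (fun e => -R p.1 e) a with hB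
  set T : Matrix (V₁ × V₂) (V₁ ⊕ G₁.edgeSet) ℝ :=
    of fun p a => Sum.elim (fun j => if p.1 = j then 1 else 0) (fun _ => 0) a with hT
  have hblocks : H.lapMatrix ℝ + vecMulVec u v =
      fromBlocks (fromBlocks ((r : ℝ) • 1 + J) (-R) (-Rᵀ) (c • 1)) B
        (of fun p a => Sum.elim (fun _ => 1) (fun e => -R p.1 e) a) K := by
    rw [hH, lapMatrix_corona G₁ G₂ hG]
    ext a b
    rcases a with (i | e) | p <;> rcases b with (j | f) | q <;>
      simp [hu, hv, hJ, hB, hR, hK, hc, hn₂, vecMulVec_apply]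
  have hTB : T * B = 0 := by
    ext p q
    simp [mul_apply, hT, hB]
  have hKT : K * T = of fun p a => Sum.elim (fun j => if p.1 = j then (r : ℝ) else 0)
      (fun _ => 0) a := by
    have hrow : ∀ w, ∑ x, G₂.lapMatrix ℝ w x = 0 := fun w => by
      simpa [mulVec, dotProduct] using congrFun (G₂.lapMatrix_mulVec_const_eq_zero (R := ℝ)) w
    ext ⟨i, w⟩ (j | e)
    · simp [mul_apply, hK, hT, Fintype.sum_prod_type, one_apply, sum_add_distrib, hrow]
    · simp [mul_apply, hT]
  have hBT : fromBlocks ((r : ℝ) • 1 + J) (-R) (-Rᵀ) (c • 1) + B * T =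
      fromBlocks ((r : ℝ) • 1 + J) (-R) (-(1 + n₂) • Rᵀ) (c • 1) := by
    ext (i | e) (j | f)
    · simp [mul_apply, hB, hT]
    · simp [mul_apply, hB, hT]
    · simp [mul_apply, hB, hT, Fintype.sum_prod_type_right, ← hn₂]
      ring
    · simp [mul_apply, hB, hT]
  have hdet := H.det_lapMatrix_add_vecMulVec u v
  rw [hblocks, det_fromBlocks_of_similar _ _ _ _ T, hTB, sub_zero, hBT] at hdet
  swap
  · rw [hTB, sub_zero, hKT]
    ext p (j | e)
    · by_cases hp : p.1 = j <;> simp [mul_apply, hT, hJ, hp]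
    · simp [mul_apply, hT]
  have hKdet : K.det = ((r : ℝ) • (1 : Matrix V₂ V₂ ℝ) + G₂.lapMatrix ℝ).det ^
      Fintype.card V₁ := by
    rw [hK]
    refine (det_kronecker _ _).trans ?_
    simp
  -- The Schur complement of the edge block is `L(G₁) / 2 + J`.
  have hA : (fromBlocks ((r : ℝ) • 1 + J) (-R) (-(1 + n₂) • Rᵀ) (c • 1)).det =
      c ^ Fintype.card G₁.edgeSet * ((1 / 2) ^ Fintype.card V₁ *
        (2 * n₁ * n₁ * G₁.numSpanningTrees)) := by
    have hinv : (c • (1 : Matrix G₁.edgeSet G₁.edgeSet ℝ)) * (c⁻¹ • 1) = 1 := by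
      simp [smul_smul, hc0]
    let := invertibleOfRightInverse _ _ hinv
    have hinv' : ⅟(c • (1 : Matrix G₁.edgeSet G₁.edgeSet ℝ)) = c⁻¹ • 1 := rfl
    rw [det_fromBlocks₂₂, hinv', det_smul, det_one, mul_one]
    congr 1
    have hschur : (r : ℝ) • 1 + J - -R * (c⁻¹ • (1 : Matrix G₁.edgeSet G₁.edgeSet ℝ)) * (-(1 + n₂) • Rᵀ) =
        (1 / 2 : ℝ) • (G₁.lapMatrix ℝ + vecMulVec ((2 : ℝ) • 1) 1) := by
      have hRR := G₁.edgeIncMatrix_mul_transpose hG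
      rw [← hR] at hRR
      have hc' : c⁻¹ * (1 + n₂) = 1 / 2 := by
        have : 1 + n₂ ≠ 0 := by positivity
        rw [hc]
        field_simp
      rw [Matrix.mul_smul, Matrix.mul_smul, Matrix.mul_one, Matrix.smul_mul, Matrix.neg_mul, hRR,
        smul_vecMulVec, ← hJ]
      have : -(1 + n₂) • c⁻¹ • -((2 * (r : ℝ)) • (1 : Matrix V₁ V₁ ℝ) - G₁.lapMatrix ℝ) =
          (1 / 2 : ℝ) • ((2 * (r : ℝ)) • (1 : Matrix V₁ V₁ ℝ) - G₁.lapMatrix ℝ) := by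
        rw [← hc', smul_smul, smul_neg, ← neg_smul]
        congr 1
        ring
      rw [this]
      module
    rw [hschur, det_smul, det_lapMatrix_add_vecMulVec]
    simp only [Pi.smul_apply, Pi.one_apply, smul_eq_mul, mul_one, sum_const, card_univ,
      nsmul_eq_mul, ← hn₁]
    ring
  have hsu : ∑ a, u a = n₁ * (1 + n₂) := by
    simp [hu, ← hn₁, ← hn₂]
    ring
  have hsv : ∑ a, v a = n₁ := by simp [hv, ← hn₁]
  rw [hKdet, hA, hsu, hsv] at hdet
  refine mul_left_cancel₀ (mul_ne_zero hn₁0 hn₁0) ?_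
  rw [show n₁ * n₁ * ((1 + n₂) * (H.numSpanningTrees : ℝ)) =
    n₁ * (1 + n₂) * n₁ * H.numSpanningTrees by ring, ← hdet, one_div, inv_pow]
  ring

end Corona

end SimpleGraph

theorem corollary2p6 {V₁ V₂ : Type*} [Fintype V₁] [DecidableEq V₁] [Nonempty V₁]
    [Fintype V₂] [DecidableEq V₂]
    (G₁ : SimpleGraph V₁) [DecidableRel G₁.Adj] (G₂ : SimpleGraph V₂) [DecidableRel G₂.Adj]
    (r₁ : ℕ) (hG₁ : G₁.IsRegularOfDegree r₁) :
    ((G₁.subdivisionVertexNeighbourhoodCorona G₂).numSpanningTrees : ℝ) =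
      ((2 + 2 * (Fintype.card V₂ : ℝ) + (r₁ : ℝ)) *
        (2 + 2 * (Fintype.card V₂ : ℝ)) ^ ((G₁.edgeFinset.card : ℤ) - (Fintype.card V₁ : ℤ)) *
        (∏ i : Fin (Fintype.card V₂),
          ((r₁ : ℝ) + G₂.laplacianEigenvalue i) ^ Fintype.card V₁) *
        (∏ i : Fin (Fintype.card V₁) with 1 ≤ i.val,
          (1 + (Fintype.card V₂ : ℝ)) * G₁.laplacianEigenvalue i)) /
      ((Fintype.card V₁ : ℝ) + (G₁.edgeFinset.card : ℝ) +
        (Fintype.card V₁ : ℝ) * (Fintype.card V₂ : ℝ)) := by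
  have hmain := G₁.card_mul_numSpanningTrees_corona G₂ hG₁
  have hedge : 2 * (G₁.edgeFinset.card : ℝ) = Fintype.card V₁ * r₁ := by
    have h := G₁.sum_degrees_eq_twice_card_edges
    simp only [hG₁.degree_eq, sum_const, card_univ, smul_eq_mul] at h
    exact_mod_cast h.symm
  have hcard : #{i : Fin (Fintype.card V₁) | 1 ≤ i.val} = Fintype.card V₁ - 1 := by
    have h : ({i : Fin (Fintype.card V₁) | 1 ≤ i.val} : Finset _) =
        univ.erase ⟨0, Fintype.card_pos⟩ := by
      ext i
      rw [mem_filter, mem_erase, ne_eq, Fin.ext_iff, Nat.one_le_iff_ne_zero]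
      tauto
    rw [h, card_erase_of_mem (mem_univ _), card_univ, Fintype.card_fin]
  rw [← SimpleGraph.edgeFinset_card, SimpleGraph.det_smul_one_add_lapMatrix] at hmain
  rw [prod_pow, prod_mul_distrib, prod_const, hcard, ← G₁.card_mul_numSpanningTrees,
    zpow_sub₀ (by positivity), zpow_natCast, zpow_natCast]
  have hk : (2 + 2 * (Fintype.card V₂ : ℝ)) = 2 * (1 + Fintype.card V₂) := by ring
  have hk0 : (1 + (Fintype.card V₂ : ℝ)) ≠ 0 := by positivity
  -- The number of vertices of the corona, rewritten with `2 m₁ = n₁ r₁`.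
  have hden : (Fintype.card V₁ : ℝ) + (G₁.edgeFinset.card : ℝ) +
      (Fintype.card V₁ : ℝ) * (Fintype.card V₂ : ℝ) =
      Fintype.card V₁ * (2 + 2 * (Fintype.card V₂ : ℝ) + r₁) / 2 := by
    linear_combination hedge / 2
  have hc0 : 2 + 2 * (Fintype.card V₂ : ℝ) + r₁ ≠ 0 := by positivity
  have hn0 : (Fintype.card V₁ : ℝ) ≠ 0 := by simp
  refine mul_left_cancel₀ hk0 ?_
  rw [hmain, hden]
  generalize ∏ i, ((r₁ : ℝ) + G₂.laplacianEigenvalue i) = P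
  have hpow : (2 + 2 * (Fintype.card V₂ : ℝ)) ^ Fintype.card V₁ =
      2 ^ Fintype.card V₁ * ((1 + Fintype.card V₂) ^ (Fintype.card V₁ - 1) *
        (1 + Fintype.card V₂)) := by
    rw [hk, mul_pow, ← pow_succ, Nat.sub_add_cancel Fintype.card_pos]
  rw [hpow]
  field_simp
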